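/- Let $V$ be a complex vector space of complex dimension $2$, and let $\omega$ be a real symplectic form on the underlying $4$-dimensional real vector space such that $\omega(iu,iv)=-\omega(u,v)$ for all $u,v\in V$. Let $\pi:\mathbb P_{\mathbb R}(V)\to\mathbb P_{\mathbb C}(V)\cong\mathbb{CP}^1$ be the projection $[v]_{\mathbb R}\mapsto[v]_{\mathbb C}$. Give $\mathbb P_{\mathbb R}(V)$ the contact structure induced by $v\mapsto v^{\perp_\omega}$; it is identified with the space of oriented contact elements of the sphere $\mathbb P_{\mathbb C}(V)$. **Definitions.** * An *isotropic flag* is a full flag $F^{(0)}\subset F^{(1)}\subset\dots\subset F^{(4)}=V$ of real subspaces, $\dim F^{(k)}=k$, with $F^{(4-k)}=(F^{(k)})^{\perp_\omega}$. * A *symplectic basis* is a basis $E=(e_1,\dots,e_4)$ with $\omega(e_1,e_4)=1$, $\omega(e_2,e_3)=-1$ and $\omega(e_i,e_j)=0$ for the other pairs $i<j$. Its flag is $F_E$, with $F_E^{(k)}=\mathrm{span}(e_1,\dots,e_k)$, and $\widehat E=(e_4,-e_3,e_2,-e_1)$. A triple of isotropic flags is *positive* if, for some symplectic basis $E$, it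 equals $(F_E,uF_E,F_{\widehat E})$, where $u$ has in the basis $E$ the matrix $$\begin{pmatrix}1&0&0&0\\a&1&0&0\\b&d&1&0\\c&ad-b&a&1\end{pmatrix},\qquad a,b,c>0,\quad ad-b>0,\quad -b^2+abd-cd>0.$$ * A curve $\xi$ of isotropic flags parametrized by the oriented circle $S^1$ is *positive* if $(\xi(t_1),\xi(t_2),\xi(t_3))$ is positive for every cyclically ordered triple of points of $S^1$. It is *Frenet* if, whenever $n_1+n_2+n_3=p\le 3$ with $0\le n_i\le 2$, for every $t$ the subspace $\xi(t_1)^{(n_1)}\oplus\xi(t_2)^{(n_2)}\oplus\xi(t_3)^{(n_3)}$ (the sum being direct near the limit) converges to $\xi(t)^{(p)}$ as the pairwise distinct points $t_1,t_2,t_3$ tend to $t$. * For pairwise transverse Lagrangians $L_1,L_2,L_3$, the *Maslov index* is $\tfrac12(k_+-k_-)$, where $(k_+,k_-)$ is the signature of the symmetric form $(x,y)\mapsto\omega(x,\sigma y)$ on $L_2$ and $\sigma$ is $+1$ on $L_1$ and $-1$ on $L_3$. * A curve $c:S^1\to\mathbb P_{\mathbb R}(V)$ has *tangent line* $\mathbb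 P(L)$ at $t$ if, after a local homeomorphic change of parameter near $t$, it has the form $s\mapsto[v(s)]_{\mathbb R}$ with $v$ of class $C^1$ and $v,v'$ everywhere linearly independent over $\mathbb R$, and $L=\mathrm{span}_{\mathbb R}(v,v')$ at the parameter value corresponding to $t$. It is *Legendrian* if it has such local parametrizations, with $\omega(v,v')=0$, near every $t$. A *contact lift* of $\gamma:S^1\to\mathbb P_{\mathbb C}(V)$ is a Legendrian curve $c$ with $\pi\circ c=\gamma$. The *osculating circle* of $\gamma=\pi\circ c$ at $t$ is the projection $\pi(\mathbb P(L))$ of the tangent line $\mathbb P(L)$ of $c$ at $t$, a round circle possibly degenerated to a point. The curve has *decreasing curvature* if the tangent lines of $c$ at the points of every cyclically ordered triple of $S^1$ are pairwise transverse Lagrangians with Maslov index $1$. **Theorem.** Let $\xi:S^1\to\{\text{isotropic flags of }V\}$ be a positive Frenet curve. Then $\xi$ is the tangent curve to the contact lift of a simple closed curve with decreasing curvature in $\mathbb P_{\mathbb C}(V)$. That is, there is a continuous injective curve $\gamma:S^1\to\mathbb P_{\mathbb C}(V)$ such that: 1. $\xi^{(1)}:S^1\to\mathbb P_{\mathbb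 R}(V)$ is a contact lift of $\gamma$, and it has decreasing curvature; 2. for every $t$, the tangent line of $\xi^{(1)}$ at $t$ is $\mathbb P(\xi(t)^{(2)})$, and $\pi(\mathbb P(\xi(t)^{(2)}))$ is the osculating circle of $\gamma$ at $t$. Moreover $\gamma$ remains simple under all contact transformations in $\mathsf{Sp}(V,\omega)$, in particular under all Möbius transformations and radial translations: for every $g\in\mathsf{Sp}(V,\omega)$ the closed curve $\pi\circ g\circ\xi^{(1)}$ is continuous and injective. -/

import Mathlib

open Module Filter Topology
open scoped LinearAlgebra.Projectivization

/-! ### Isotropic flags, positivity, Frenet curves -/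

section Flags

variable {V : Type*} [AddCommGroup V] [Module ℝ V]

/-- An isotropic flag: a full flag `F⁽⁰⁾ ⊂ F⁽¹⁾ ⊂ F⁽²⁾ ⊂ F⁽³⁾ ⊂ F⁽⁴⁾` with
`F⁽⁴⁻ᵏ⁾` the `ω`-orthogonal of `F⁽ᵏ⁾` (and `Fin.rev k = 4 - k` on `Fin 5`). -/
structure IsotropicFlag (ω : LinearMap.BilinForm ℝ V) where
  sub : Fin 5 → Submodule ℝ V
  mono : Monotone sub
  finrank_sub : ∀ k, finrank ℝ (sub k) = (k : ℕ)
  sub_rev : ∀ k, sub k.rev = ω.orthogonal (sub k)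

/-- The one-dimensional part of a flag, as a point of the real projective space. -/
noncomputable def IsotropicFlag.point {ω : LinearMap.BilinForm ℝ V} (F : IsotropicFlag ω) :
    ℙ ℝ V :=
  Projectivization.mk'' (F.sub 1) (F.finrank_sub 1)

/-- The matrix of the symplectic form in a symplectic basis. -/
def symplecticMatrix : Matrix (Fin 4) (Fin 4) ℝ :=
  !![0, 0, 0, 1; 0, 0, -1, 0; 0, 1, 0, 0; -1, 0, 0, 0]

/-- A basis in which `ω` has the matrix `symplecticMatrix`. -/
def IsSymplecticBasis (ω : LinearMap.BilinForm ℝ V) (E : Basis (Fin 4) ℝ V) : Prop :=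
  ∀ i j, ω (E i) (E j) = symplecticMatrix i j

/-- The span of the first `k` vectors of a `4`-tuple. -/
def flagSpan (e : Fin 4 → V) (k : Fin 5) : Submodule ℝ V :=
  Submodule.span ℝ (e '' {i | (i : ℕ) < (k : ℕ)})

/-- The opposite `4`-tuple `(e₄, -e₃, e₂, -e₁)`. -/
def oppositeBasis (e : Fin 4 → V) : Fin 4 → V :=
  ![e 3, -e 2, e 1, -e 0]

/-- The elements of the unipotent group of lower triangular symplectic matrices. -/
def lowerUnipotent (a b c d : ℝ) : Matrix (Fin 4) (Fin 4) ℝ :=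
  !![1, 0, 0, 0; a, 1, 0, 0; b, d, 1, 0; c, a * d - b, a, 1]

/-- The positive semigroup of the lower unipotent group. -/
def positiveSemigroup : Set (Matrix (Fin 4) (Fin 4) ℝ) :=
  {u | ∃ a b c d : ℝ, u = lowerUnipotent a b c d ∧ 0 < a ∧ 0 < b ∧ 0 < c ∧
    0 < a * d - b ∧ 0 < -b ^ 2 + a * b * d - c * d}

/-- A triple of isotropic flags is positive if in some symplectic basis `E` it is
`(F_E, u F_E, F_Ê)`, with `F_E` the flag of `E`, `F_Ê` the flag of the opposite basis,
and `u` in the positive semigroup. -/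
def IsPositiveTriple {ω : LinearMap.BilinForm ℝ V} (F₁ F₂ F₃ : IsotropicFlag ω) : Prop :=
  ∃ E : Basis (Fin 4) ℝ V, IsSymplecticBasis ω E ∧ ∃ u ∈ positiveSemigroup,
    ∀ k, F₁.sub k = flagSpan E k ∧
      F₂.sub k = (flagSpan E k).map (Matrix.toLin E E u) ∧
      F₃.sub k = flagSpan (oppositeBasis E) k

/-- A closed curve of flags is positive if all its cyclically ordered triples are. -/
def IsPositiveCurve {ω : LinearMap.BilinForm ℝ V} (ξ : UnitAddCircle → IsotropicFlag ω) : Prop :=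
  ∀ t₁ t₂ t₃, sbtw t₁ t₂ t₃ → IsPositiveTriple (ξ t₁) (ξ t₂) (ξ t₃)

/-- Convergence of subspaces in the Grassmannian of `p`-planes, with its usual topology
(the quotient of the space of `p`-frames): eventually `U i` is a `p`-plane, and frames of the
`U i` converge to a frame of `L`. -/
def GrassmannTendsto {ι : Type*} [TopologicalSpace V] (p : ℕ) (U : ι → Submodule ℝ V)
    (l : Filter ι) (L : Submodule ℝ V) : Prop :=
  ∃ (b : ι → Fin p → V) (b₀ : Fin p → V),
    (∀ᶠ i in l, LinearIndependent ℝ (b i) ∧ Submodule.span ℝ (Set.range (b i)) = U i) ∧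
    LinearIndependent ℝ b₀ ∧ Submodule.span ℝ (Set.range b₀) = L ∧ Tendsto b l (𝓝 b₀)

/-- A curve of flags is Frenet if, for `n₁ + n₂ + n₃ = p ≤ 3` with all `nᵢ ≤ 2`,
`ξ(t₁)⁽ⁿ¹⁾ ⊕ ξ(t₂)⁽ⁿ²⁾ ⊕ ξ(t₃)⁽ⁿ³⁾` converges to `ξ(t)⁽ᵖ⁾` as the pairwise distinct points
`t₁, t₂, t₃` tend to `t`. That the sum is direct near the limit is part of
`GrassmannTendsto p`, since `n₁ + n₂ + n₃ = p`. -/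
def IsFrenet [TopologicalSpace V] {ω : LinearMap.BilinForm ℝ V}
    (ξ : UnitAddCircle → IsotropicFlag ω) : Prop :=
  ∀ n₁ n₂ n₃ p : Fin 5, (n₁ : ℕ) ≤ 2 → (n₂ : ℕ) ≤ 2 → (n₃ : ℕ) ≤ 2 → (p : ℕ) ≤ 3 →
    (n₁ : ℕ) + n₂ + n₃ = p → ∀ t : UnitAddCircle,
      GrassmannTendsto (p : ℕ)
        (fun s : UnitAddCircle × UnitAddCircle × UnitAddCircle =>
          (ξ s.1).sub n₁ ⊔ (ξ s.2.1).sub n₂ ⊔ (ξ s.2.2).sub n₃)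
        (𝓝 (t, t, t) ⊓ 𝓟 {s | s.1 ≠ s.2.1 ∧ s.1 ≠ s.2.2 ∧ s.2.1 ≠ s.2.2})
        ((ξ t).sub p)

/-! ### The Maslov index -/

/-- The involution `σ = I ⊕ -I` of `V = L₁ ⊕ L₃`. -/
noncomputable def splittingInvolution {L₁ L₃ : Submodule ℝ V} (h : IsCompl L₁ L₃) :
    V →ₗ[ℝ] V :=
  L₁.projection L₃ h - L₃.projection L₁ h.symm

/-- The Maslov form `(u, v) ↦ ω(u, σ v)` on `L₂`. -/
noncomputable def maslovForm (ω : LinearMap.BilinForm ℝ V) {L₁ L₃ : Submodule ℝ V}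
    (h : IsCompl L₁ L₃) (L₂ : Submodule ℝ V) : LinearMap.BilinForm ℝ L₂ :=
  LinearMap.BilinForm.restrict (ω.compl₂ (splittingInvolution h)) L₂

/-- The Maslov index `(k₊ - k₋) / 2`, where `(k₊, k₋)` is the signature of the Maslov form. -/
noncomputable def maslovIndex (ω : LinearMap.BilinForm ℝ V) {L₁ L₃ : Submodule ℝ V}
    (h : IsCompl L₁ L₃) (L₂ : Submodule ℝ V) : ℚ :=
  ((sigPos (maslovForm ω h L₂).toQuadraticMap : ℚ)
    - (sigNeg (maslovForm ω h L₂).toQuadraticMap : ℚ)) / 2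

end Flags

/-! ### Legendrian curves and their projections to the complex projective line -/

section Curves

variable {V : Type*} [NormedAddCommGroup V] [NormedSpace ℂ V]

/-- `φ` and `v` are a local regular `C¹` parametrization of the curve `c`: after the change of
parameter `φ`, the curve is `s ↦ [v s]` with `v` of class `C¹` and `v`, `v'` independent
(so that the projective curve `s ↦ [v s]` is immersed). -/
structure IsRegularParam (c : UnitAddCircle → ℙ ℝ V)
    (φ : OpenPartialHomeomorph ℝ UnitAddCircle) (v : ℝ → V) : Prop where
  contDiffOn : ContDiffOn ℝ 1 v φ.source
  indep : ∀ s ∈ φ.source, LinearIndependent ℝ ![v s, deriv v s]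
  lift : ∀ s ∈ φ.source, (c (φ s)).submodule = Submodule.span ℝ {v s}

/-- The projective line `ℙ(L)` is the tangent line of the curve `c` at the parameter `t`. -/
def HasTangentLine (c : UnitAddCircle → ℙ ℝ V) (t : UnitAddCircle) (L : Submodule ℝ V) : Prop :=
  ∃ φ v, IsRegularParam c φ v ∧ t ∈ φ.target ∧
    L = Submodule.span ℝ {v (φ.symm t), deriv v (φ.symm t)}

/-- A Legendrian curve: it is everywhere tangent to the contact distribution
`[v] ↦ ℙ(v^⊥)` of the real projective space. -/
def IsLegendrian (ω : LinearMap.BilinForm ℝ V) (c : UnitAddCircle → ℙ ℝ V) : Prop :=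
  ∀ t, ∃ φ v, IsRegularParam c φ v ∧ t ∈ φ.target ∧
    ∀ s ∈ φ.source, ω (v s) (deriv v s) = 0

/-- The projection `π`, `[v]_ℝ ↦ [v]_ℂ`. -/
noncomputable def realToComplex : ℙ ℝ V → ℙ ℂ V :=
  Projectivization.lift (fun v => Projectivization.mk ℂ v.1 v.2) (by
    rintro ⟨a, ha⟩ ⟨b, hb⟩ t h
    exact (Projectivization.mk_eq_mk_iff' ℂ _ _ _ _).2 ⟨(t : ℂ), by simpa using h.symm⟩)

/-- The quotient topology on the complex projective line. -/
instance complexProjectiveTopology : TopologicalSpace (ℙ ℂ V) :=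
  inferInstanceAs (TopologicalSpace (Quotient (projectivizationSetoid ℂ V)))

/-- A simple closed curve. -/
def IsSimpleClosedCurve (γ : UnitAddCircle → ℙ ℂ V) : Prop :=
  Continuous γ ∧ Function.Injective γ

/-- `c` is a contact lift of `γ`: a Legendrian curve that projects to `γ`. -/
def IsContactLift (ω : LinearMap.BilinForm ℝ V) (c : UnitAddCircle → ℙ ℝ V)
    (γ : UnitAddCircle → ℙ ℂ V) : Prop :=
  IsLegendrian ω c ∧ ∀ t, realToComplex (c t) = γ t

/-- The Legendrian curve `c` (and its projection) has decreasing curvature: its tangent lines at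
cyclically ordered points are pairwise transverse of Maslov index `1`. -/
def HasDecreasingCurvature (ω : LinearMap.BilinForm ℝ V) (c : UnitAddCircle → ℙ ℝ V) : Prop :=
  ∃ T : UnitAddCircle → Submodule ℝ V, (∀ t, HasTangentLine c t (T t)) ∧
    ∀ t₁ t₂ t₃, sbtw t₁ t₂ t₃ →
      IsCompl (T t₁) (T t₂) ∧ IsCompl (T t₂) (T t₃) ∧
        ∃ h : IsCompl (T t₁) (T t₃), maslovIndex ω h (T t₂) = 1

/-- The image in the complex projective line of a real subspace of `V`. -/
def complexImage (L : Submodule ℝ V) : Set (ℙ ℂ V) :=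
  {x | ∃ (v : V) (hv : v ≠ 0), v ∈ L ∧ x = Projectivization.mk ℂ v hv}

/-- A round circle of the complex projective line (the image of the real projective line under a
projective isomorphism), possibly degenerated to a point. -/
def IsRoundCircle (C : Set (ℙ ℂ V)) : Prop :=
  (∃ u w : V, LinearIndependent ℂ ![u, w] ∧ C = complexImage (Submodule.span ℝ {u, w})) ∨
    ∃ x, C = {x}

/-- `C` is the osculating circle at `t` to the projection of the Legendrian curve `c`: the round
circle that is the projection of the tangent line of `c` at `t`. -/
def IsOsculatingCircle (c : UnitAddCircle → ℙ ℝ V) (t : UnitAddCircle) (C : Set (ℙ ℂ V)) : Prop :=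
  IsRoundCircle C ∧ ∃ L, HasTangentLine c t L ∧ C = complexImage L

end Curves

/-!
The theorem splits into an algebraic part, which rests on positivity, and an analytic part, which
rests on the Frenet property alone.

*Positivity.* The normal form of a positive triple shows at once that the lines of its extreme
flags are not `ω`-orthogonal (`IsPositiveTriple.pairing_ne_zero`), that their Lagrangian planes are
transverse (`IsPositiveTriple.isCompl`), and that the Maslov form on the middle plane is
`2 ((ab - c) s² + 2 b s t + d t²)`, which the inequalities defining the positive semigroup make
positive definite; so the Maslov index is `1` (`IsPositiveTriple.maslovIndex_eq_one`). On the other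
hand `ω (i u, i v) = -ω (u, v)` makes every complex line Lagrangian. Two points of the curve in the
same complex line would therefore be `ω`-orthogonal, which is excluded, and this remains true after
applying a symplectic map: all the projected curves are injective
(`IsPositiveCurve.injective_projection`).

*The Frenet property.* Choose a linear map `A : V → ℝ²` that is injective on the plane of `ξ t₀`
and whose first coordinate does not vanish on its line. For `t` near `t₀` let `v t` be the vector of
`(ξ t)⁽¹⁾` with first coordinate `1`, and `w t` the vector of `(ξ t)⁽²⁾` with `A (w t) = (0, 1)`.
Convergence in the Grassmannian makes such normalized vectors converge
(`GrassmannTendsto.tendsto_of_apply_eq`). With `(n₁, n₂, n₃) = (1, 0, 0)` and `(2, 0, 0)` this says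
that `v` and `w` are continuous. With `(1, 1, 0)` it says that the second coordinate `x` of `A ∘ v`
is injective near `t₀`, and that `(v s - v s') / (x s - x s')`, the normalized vector of the secant
plane, tends to `w t` as `s, s' → t` (`IsFrenet.tendsto_slope`). So `x` is a local coordinate of the
circle, in which `v` is of class `C¹` with derivative `w`, and the plane `(ξ t)⁽²⁾` spanned by `v`
and `w` is the tangent line (`IsFrenet.exists_isRegularParam`). The curve is Legendrian since these
planes are Lagrangian.
-/

/-! ### Positive triples and the Maslov index -/

section PositiveTriples

variable {V : Type*} [AddCommGroup V] [Module ℝ V] {ω : LinearMap.BilinForm ℝ V}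

lemma flagSpan_one (e : Fin 4 → V) : flagSpan e 1 = Submodule.span ℝ {e 0} := by
  have : {i : Fin 4 | (i : ℕ) < ((1 : Fin 5) : ℕ)} = {0} := by
    ext i; fin_cases i <;> simp
  rw [flagSpan, this, Set.image_singleton]

lemma flagSpan_two (e : Fin 4 → V) : flagSpan e 2 = Submodule.span ℝ {e 0, e 1} := by
  have : {i : Fin 4 | (i : ℕ) < ((2 : Fin 5) : ℕ)} = {0, 1} := by
    ext i; fin_cases i <;> simp
  rw [flagSpan, this, Set.image_pair]

lemma IsPositiveTriple.pairing_ne_zero {F₁ F₂ F₃ : IsotropicFlag ω}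
    (h : IsPositiveTriple F₁ F₂ F₃) {v w : V} (hv : v ∈ F₁.sub 1) (hw : w ∈ F₃.sub 1)
    (hv0 : v ≠ 0) (hw0 : w ≠ 0) : ω v w ≠ 0 := by
  obtain ⟨E, hE, u, -, hF⟩ := h
  rw [(hF 1).1, flagSpan_one, Submodule.mem_span_singleton] at hv
  rw [(hF 1).2.2, flagSpan_one, Submodule.mem_span_singleton] at hw
  obtain ⟨a, rfl⟩ := hv
  obtain ⟨b, rfl⟩ := hw
  have h03 := hE 0 3
  simp only [symplecticMatrix, Matrix.of_apply, Matrix.cons_val] at h03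
  simp only [ne_eq, smul_eq_zero, not_or] at hv0 hw0
  simp [oppositeBasis, h03, hv0.1, hw0.1]

lemma isCompl_span_pairs (E : Basis (Fin 4) ℝ V) :
    IsCompl (Submodule.span ℝ {E 0, E 1}) (Submodule.span ℝ {E 3, -E 2}) := by
  rw [isCompl_iff, disjoint_iff, codisjoint_iff]
  constructor
  · rw [eq_bot_iff]
    rintro x ⟨h₁, h₂⟩
    obtain ⟨a, b, rfl⟩ := Submodule.mem_span_pair.1 h₁
    obtain ⟨c, d, h⟩ := Submodule.mem_span_pair.1 h₂
    have h0 := congr_arg (fun y => E.repr y 0) h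
    have h1 := congr_arg (fun y => E.repr y 1) h
    simp at h0 h1
    simp [← h0, ← h1]
  · rw [eq_top_iff, ← E.span_eq, Submodule.span_le]
    rintro _ ⟨i, rfl⟩
    fin_cases i
    · exact Submodule.mem_sup_left (Submodule.subset_span (by simp))
    · exact Submodule.mem_sup_left (Submodule.subset_span (by simp))
    · exact Submodule.mem_sup_right
        (Submodule.mem_span_pair.2 ⟨0, -1, by simp⟩)
    · exact Submodule.mem_sup_right (Submodule.subset_span (by simp))

lemma IsPositiveTriple.isCompl {F₁ F₂ F₃ : IsotropicFlag ω} (h : IsPositiveTriple F₁ F₂ F₃) :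
    IsCompl (F₁.sub 2) (F₃.sub 2) := by
  obtain ⟨E, -, u, -, hF⟩ := h
  rw [(hF 2).1, (hF 2).2.2, flagSpan_two, flagSpan_two]
  exact isCompl_span_pairs E

lemma splittingInvolution_add {L₁ L₃ : Submodule ℝ V} (h : IsCompl L₁ L₃) {p q : V}
    (hp : p ∈ L₁) (hq : q ∈ L₃) : splittingInvolution h (p + q) = p - q := by
  lift p to L₁ using hp
  lift q to L₃ using hq
  simp [splittingInvolution]

/-- The Maslov index is half the dimension if the Maslov form is positive definite. -/
lemma maslovIndex_eq_of_pos [FiniteDimensional ℝ V] {L₁ L₃ : Submodule ℝ V} (h : IsCompl L₁ L₃)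
    (L₂ : Submodule ℝ V) (hpos : ∀ x ∈ L₂, x ≠ 0 → 0 < ω x (splittingInvolution h x)) :
    maslovIndex ω h L₂ = (finrank ℝ L₂ : ℚ) / 2 := by
  set Q : QuadraticForm ℝ L₂ := (maslovForm ω h L₂).toQuadraticMap with hQ
  have hQpos : ∀ x : L₂, x ≠ 0 → 0 < Q x := fun x hx => hpos x x.2 (by simpa using hx)
  have h₁ : finrank ℝ L₂ ≤ sigPos Q := by
    have := le_sigPos_of_posDef Q (V := ⊤) (fun x hx => hQpos x (by simpa using hx))
    rwa [finrank_top] at this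
  have h₂ : sigNeg Q + finrank ℝ L₂ ≤ finrank ℝ L₂ := by
    have := QuadraticForm.sigPos_add_finrank_le_of_nonpos (Q := -Q) (V := ⊤) (fun x _ => by
      rcases eq_or_ne x 0 with rfl | hx
      · simp
      · simpa using (hQpos x hx).le)
    rwa [finrank_top, sigPos_neg] at this
  have h₃ := sigPos_le_finrank Q
  rw [maslovIndex, ← hQ, show sigPos Q = finrank ℝ L₂ by omega, show sigNeg Q = 0 by omega]
  simp

lemma IsPositiveTriple.maslovIndex_eq_one [FiniteDimensional ℝ V] {F₁ F₂ F₃ : IsotropicFlag ω}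
    (hF : IsPositiveTriple F₁ F₂ F₃) (h : IsCompl (F₁.sub 2) (F₃.sub 2)) :
    maslovIndex ω h (F₂.sub 2) = 1 := by
  obtain ⟨E, hE, u, ⟨a, b, c, d, rfl, ha, hb, hc, had, hdet⟩, hF⟩ := hF
  have h₁ := (hF 2).1
  have h₂ := (hF 2).2.1
  have h₃ := (hF 2).2.2
  rw [flagSpan_two] at h₁ h₂ h₃
  rw [maslovIndex_eq_of_pos h, F₂.finrank_sub]
  · norm_num
  intro x hx hx0
  rw [h₂, Submodule.mem_map] at hx
  obtain ⟨y, hy, rfl⟩ := hx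
  obtain ⟨s, t, rfl⟩ := Submodule.mem_span_pair.1 hy
  have hd : 0 < d := by nlinarith
  -- the decomposition of `u (s e₁ + t e₂)` along the two transverse Lagrangians
  have hsplit : Matrix.toLin E E (lowerUnipotent a b c d) (s • E 0 + t • E 1) =
      (s • E 0 + (s * a + t) • E 1) +
        ((s * b + t * d) • E 2 + (s * c + t * (a * d - b)) • E 3) := by
    simp only [map_add, map_smul, Matrix.toLin_self, lowerUnipotent, Fin.sum_univ_four,
      Matrix.of_apply, Matrix.cons_val]
    module
  have hp : s • E 0 + (s * a + t) • E 1 ∈ F₁.sub 2 := by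
    rw [h₁]; exact Submodule.mem_span_pair.2 ⟨_, _, rfl⟩
  have hq : (s * b + t * d) • E 2 + (s * c + t * (a * d - b)) • E 3 ∈ F₃.sub 2 := by
    rw [h₃]
    refine Submodule.mem_span_pair.2 ⟨s * c + t * (a * d - b), -(s * b + t * d), ?_⟩
    simp only [oppositeBasis, Matrix.cons_val]
    module
  have hst : s ≠ 0 ∨ t ≠ 0 := by
    by_contra! hst
    exact hx0 (by simp [hst.1, hst.2])
  rw [hsplit, splittingInvolution_add h hp hq]
  have hval : ∀ i j, ω (E i) (E j) = symplecticMatrix i j := hE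
  have key : ω ((s • E 0 + (s * a + t) • E 1) +
        ((s * b + t * d) • E 2 + (s * c + t * (a * d - b)) • E 3))
      ((s • E 0 + (s * a + t) • E 1) -
        ((s * b + t * d) • E 2 + (s * c + t * (a * d - b)) • E 3)) =
      2 * ((a * b - c) * s ^ 2 + 2 * b * s * t + d * t ^ 2) := by
    simp only [map_add, map_sub, map_smul, LinearMap.add_apply, LinearMap.smul_apply, hval,
      symplecticMatrix, Matrix.of_apply, Matrix.cons_val, smul_eq_mul]
    ring
  rw [key]
  -- completing the square
  have hsq : d * (2 * ((a * b - c) * s ^ 2 + 2 * b * s * t + d * t ^ 2)) =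
      2 * ((d * t + b * s) ^ 2 + (-b ^ 2 + a * b * d - c * d) * s ^ 2) := by ring
  refine (mul_pos_iff_of_pos_left hd).1 ?_
  rw [hsq]
  rcases eq_or_ne s 0 with rfl | hs
  · have ht : t ≠ 0 := by simpa using hst
    have := mul_ne_zero hd.ne' ht
    simp only [mul_zero, add_zero]
    positivity
  · positivity

end PositiveTriples

/-! ### Convergence in the Grassmannian -/

section Grassmannian

variable {V : Type*} [NormedAddCommGroup V] [NormedSpace ℝ V] {ι : Type*} {l : Filter ι}
  {p : ℕ} {U : ι → Submodule ℝ V} {L : Submodule ℝ V}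

/-- Sections of a convergent family of `p`-planes over a fixed affine chart: if the linear map
`A : V → ℝᵖ` is injective on the limit, then it is eventually bijective on the planes, and the
points of the planes with a prescribed value of `A` converge. -/
lemma GrassmannTendsto.exists_tendsto_section (h : GrassmannTendsto p U l L)
    (A : V →L[ℝ] (Fin p → ℝ)) (hA : ∀ y ∈ L, A y = 0 → y = 0) {y : V} (hy : y ∈ L) :
    ∃ z : ι → V, Tendsto z l (𝓝 y) ∧ (∀ᶠ i in l, z i ∈ U i ∧ A (z i) = A y ∧
      (∀ x ∈ U i, A x = A y → x = z i) ∧ ∀ c, ∃ x ∈ U i, A x = c) := by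
  obtain ⟨b, b₀, hb, hli₀, hspan₀, hlim⟩ := h
  let M : (Fin p → V) → Matrix (Fin p) (Fin p) ℝ := fun f => Matrix.of fun r j => A (f j) r
  have hMmul : ∀ (f : Fin p → V) (c : Fin p → ℝ), A (∑ j, c j • f j) = (M f).mulVec c := by
    intro f c
    ext r
    simp [M, Matrix.mulVec, dotProduct, mul_comm]
  have hMcont : Continuous M := by
    refine continuous_matrix fun r j => ?_
    exact (continuous_apply r).comp (A.continuous.comp (continuous_apply j))
  have hdet₀ : (M b₀).det ≠ 0 := by
    intro h0
    obtain ⟨c, hc, hc0⟩ := Matrix.exists_mulVec_eq_zero_iff.2 h0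
    rw [← hMmul] at hc0
    have hmem : ∑ j, c j • b₀ j ∈ L := by
      rw [← hspan₀]
      exact Submodule.sum_mem _ fun j _ =>
        Submodule.smul_mem _ _ (Submodule.subset_span ⟨j, rfl⟩)
    exact hc (funext (Fintype.linearIndependent_iff.1 hli₀ c (hA _ hmem hc0)))
  have hdetlim : Tendsto (fun i => (M (b i)).det) l (𝓝 (M b₀).det) :=
    (hMcont.matrix_det.tendsto b₀).comp hlim
  have hdet : ∀ᶠ i in l, (M (b i)).det ≠ 0 := hdetlim.eventually_ne hdet₀
  -- the inverse of the coordinate matrix gives the coefficients of the section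
  let C : (Fin p → V) → Fin p → ℝ := fun f => ((M f).det⁻¹ • (M f).adjugate).mulVec (A y)
  have hMC : ∀ f : Fin p → V, (M f).det ≠ 0 → ∀ c : Fin p → ℝ,
      (M f).mulVec (((M f).det⁻¹ • (M f).adjugate).mulVec c) = c := by
    intro f hf c
    rw [Matrix.mulVec_mulVec, Matrix.mul_smul, Matrix.mul_adjugate, smul_smul,
      inv_mul_cancel₀ hf, one_smul, Matrix.one_mulVec]
  have hinj : ∀ f : Fin p → V, (M f).det ≠ 0 → ∀ c c' : Fin p → ℝ,
      (M f).mulVec c = (M f).mulVec c' → c = c' := by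
    intro f hf c c' hcc
    exact Matrix.mulVec_injective_of_isUnit
      ((Matrix.isUnit_iff_isUnit_det _).2 (isUnit_iff_ne_zero.2 hf)) hcc
  refine ⟨fun i => ∑ j, C (b i) j • b i j, ?_, ?_⟩
  · have hy' : y = ∑ j, C b₀ j • b₀ j := by
      rw [← hspan₀] at hy
      obtain ⟨c, rfl⟩ := (Submodule.mem_span_range_iff_exists_fun ℝ).1 hy
      have : c = C b₀ := by
        refine hinj b₀ hdet₀ _ _ ?_
        rw [hMC b₀ hdet₀, hMmul]
      rw [← this]
    have hC : Tendsto (fun i => C (b i)) l (𝓝 (C b₀)) := by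
      have h1 : Tendsto (fun i => (M (b i)).det⁻¹ • (M (b i)).adjugate) l
          (𝓝 ((M b₀).det⁻¹ • (M b₀).adjugate)) :=
        (hdetlim.inv₀ hdet₀).smul ((hMcont.matrix_adjugate.tendsto b₀).comp hlim)
      have h2 : Continuous fun N : Matrix (Fin p) (Fin p) ℝ => N.mulVec (A y) :=
        continuous_id.matrix_mulVec continuous_const
      exact (h2.tendsto _).comp h1
    rw [hy']
    exact tendsto_finsetSum _ fun j _ => (tendsto_pi_nhds.1 hC j).smul (tendsto_pi_nhds.1 hlim j)
  · filter_upwards [hb, hdet] with i hbi hdi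
    have hmem : ∀ c : Fin p → ℝ, ∑ j, c j • b i j ∈ U i := by
      intro c
      rw [← hbi.2]
      exact Submodule.sum_mem _ fun j _ =>
        Submodule.smul_mem _ _ (Submodule.subset_span ⟨j, rfl⟩)
    refine ⟨hmem _, ?_, ?_, fun c => ⟨_, hmem (((M (b i)).det⁻¹ • (M (b i)).adjugate).mulVec c),
      ?_⟩⟩
    · rw [hMmul]; exact hMC _ hdi _
    · intro x hx hxy
      rw [← hbi.2] at hx
      obtain ⟨c, rfl⟩ := (Submodule.mem_span_range_iff_exists_fun ℝ).1 hx
      rw [hMmul] at hxy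
      have : c = C (b i) := hinj _ hdi _ _ (by rw [hxy]; exact (hMC _ hdi _).symm)
      rw [← this]
    · rw [hMmul]; exact hMC _ hdi _

lemma GrassmannTendsto.eventually_exists (h : GrassmannTendsto p U l L)
    (A : V →L[ℝ] (Fin p → ℝ)) (hA : ∀ y ∈ L, A y = 0 → y = 0) :
    ∀ᶠ i in l, ∀ c, ∃ x ∈ U i, A x = c := by
  obtain ⟨z, -, hz⟩ := h.exists_tendsto_section A hA L.zero_mem
  exact hz.mono fun i hi => hi.2.2.2

lemma GrassmannTendsto.tendsto_of_apply_eq (h : GrassmannTendsto p U l L)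
    (A : V →L[ℝ] (Fin p → ℝ)) (hA : ∀ y ∈ L, A y = 0 → y = 0) {y : V} (hy : y ∈ L)
    {x : ι → V} (hx : ∀ᶠ i in l, x i ∈ U i ∧ A (x i) = A y) : Tendsto x l (𝓝 y) := by
  obtain ⟨z, hlim, hz⟩ := h.exists_tendsto_section A hA hy
  refine hlim.congr' ?_
  filter_upwards [hz, hx] with i hzi hxi
  exact (hzi.2.2.1 _ hxi.1 hxi.2).symm

end Grassmannian

/-! ### Local analysis on the circle -/

section Circle

lemma infinite_of_mem_nhds_unitAddCircle {t : UnitAddCircle} {W : Set UnitAddCircle}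
    (hW : W ∈ 𝓝 t) : W.Infinite := by
  have : Nontrivial UnitAddCircle := by
    refine ⟨((0 : ℝ) : UnitAddCircle), ((1 / 2 : ℝ) : UnitAddCircle), fun h => ?_⟩
    have := (AddCircle.coe_eq_coe_iff_of_mem_Ico (p := (1 : ℝ)) (a := 0)
      (by norm_num) (by norm_num)).1 h
    norm_num at this
  exact infinite_of_mem_nhds t hW

/-- Every pair of distinct points close to `t` extends to a triple of distinct points close
to `t`. -/
lemma eventually_pair_of_eventually_triple {t : UnitAddCircle}
    {S : UnitAddCircle × UnitAddCircle → Prop}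
    (h : ∀ᶠ s : UnitAddCircle × UnitAddCircle × UnitAddCircle in
      𝓝 (t, t, t) ⊓ 𝓟 {s | s.1 ≠ s.2.1 ∧ s.1 ≠ s.2.2 ∧ s.2.1 ≠ s.2.2}, S (s.1, s.2.1)) :
    ∀ᶠ s in 𝓝 (t, t) ⊓ 𝓟 {s : UnitAddCircle × UnitAddCircle | s.1 ≠ s.2}, S s := by
  rw [eventually_inf_principal, nhds_prod_eq, nhds_prod_eq, eventually_prod_iff] at h
  rw [eventually_inf_principal, nhds_prod_eq, eventually_prod_iff]
  obtain ⟨p, hp, q, hq, h⟩ := h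
  obtain ⟨q₁, hq₁, q₂, hq₂, hqq⟩ := eventually_prod_iff.1 hq
  refine ⟨p, hp, q₁, hq₁, fun {x} hx {y} hy hxy => ?_⟩
  obtain ⟨z, hz, hzxy⟩ := (infinite_of_mem_nhds_unitAddCircle hq₂).exists_notMem_finset {x, y}
  simp only [Finset.mem_insert, Finset.mem_singleton, not_or] at hzxy
  exact h hx (hqq hy hz) ⟨hxy, Ne.symm hzxy.1, Ne.symm hzxy.2⟩

lemma eventually_nhds_of_eventually_triple {t : UnitAddCircle} {S : UnitAddCircle → Prop}
    (h : ∀ᶠ s : UnitAddCircle × UnitAddCircle × UnitAddCircle in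
      𝓝 (t, t, t) ⊓ 𝓟 {s | s.1 ≠ s.2.1 ∧ s.1 ≠ s.2.2 ∧ s.2.1 ≠ s.2.2}, S s.1) :
    ∀ᶠ s in 𝓝 t, S s := by
  have h := eventually_pair_of_eventually_triple (S := fun s => S s.1) h
  rw [eventually_inf_principal, nhds_prod_eq, eventually_prod_iff] at h
  obtain ⟨p, hp, q, hq, h⟩ := h
  filter_upwards [hp] with x hx
  obtain ⟨z, hz, hzx⟩ := (infinite_of_mem_nhds_unitAddCircle hq).exists_notMem_finset {x}
  exact h hx hz (by simpa [eq_comm] using hzx)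

lemma image_mem_nhds_of_continuousOn_of_injOn {g : ℝ → ℝ} {T : Set ℝ} {a : ℝ} (hT : T ∈ 𝓝 a)
    (hc : ContinuousOn g T) (hi : T.InjOn g) : g '' T ∈ 𝓝 (g a) := by
  obtain ⟨ε, hε, hεT⟩ := Metric.nhds_basis_closedBall.mem_iff.1 hT
  rw [Real.closedBall_eq_Icc] at hεT
  have hle : a - ε ≤ a + ε := by linarith
  have ha : a ∈ Set.Icc (a - ε) (a + ε) := ⟨by linarith, by linarith⟩
  have hsub : Set.uIcc (g (a - ε)) (g (a + ε)) ⊆ g '' T := by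
    refine (intermediate_value_uIcc ?_).trans (Set.image_mono ?_) <;> rw [Set.uIcc_of_le hle]
    exacts [hc.mono hεT, hεT]
  refine mem_of_superset ?_ hsub
  rcases (hc.mono hεT).strictMonoOn_of_injOn_Icc' hle (hi.mono hεT) with h | h
  · have h₁ := h (Set.left_mem_Icc.2 hle) ha (by linarith)
    have h₂ := h ha (Set.right_mem_Icc.2 hle) (by linarith)
    rw [Set.uIcc_of_le (h₁.trans h₂).le]
    exact Icc_mem_nhds h₁ h₂
  · have h₁ := h (Set.left_mem_Icc.2 hle) ha (by linarith)
    have h₂ := h ha (Set.right_mem_Icc.2 hle) (by linarith)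
    rw [Set.uIcc_of_ge (h₂.trans h₁).le]
    exact Icc_mem_nhds h₂ h₁

/-- A continuous injective real function on an open subset of the circle is, near every point,
the inverse of a local parametrization of the circle. -/
lemma exists_openPartialHomeomorph_symm_eq {f : UnitAddCircle → ℝ} {U : Set UnitAddCircle}
    (hU : IsOpen U) (hf : ContinuousOn f U) (hinj : U.InjOn f) {t₀ : UnitAddCircle}
    (ht₀ : t₀ ∈ U) :
    ∃ φ : OpenPartialHomeomorph ℝ UnitAddCircle, t₀ ∈ φ.target ∧ φ.target ⊆ U ∧
      ∀ t ∈ φ.target, φ.symm t = f t := by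
  obtain ⟨r, rfl⟩ := QuotientAddGroup.mk_surjective t₀
  -- the universal cover, restricted to a period centred at `r` and then to the preimage of `U`
  let κ : OpenPartialHomeomorph ℝ UnitAddCircle :=
    AddCircle.openPartialHomeomorphCoe 1 (r - 1 / 2)
  have hr : r ∈ κ.source := by
    change r ∈ Set.Ioo (r - 1 / 2) (r - 1 / 2 + 1)
    constructor <;> linarith
  have hW : κ.source ∩ κ ⁻¹' U ∈ 𝓝 r :=
    (κ.isOpen_inter_preimage hU).mem_nhds ⟨hr, ht₀⟩
  let κU := κ.restrOpen (κ.source ∩ κ ⁻¹' U) (κ.isOpen_inter_preimage hU)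
  have hmaps : Set.MapsTo κU κU.source U := fun x hx => hx.2.2
  let g : ℝ → ℝ := fun x => f (κU x)
  have hgc : ContinuousOn g κU.source := hf.comp κU.continuousOn hmaps
  have hgi : κU.source.InjOn g := hinj.comp κU.injOn hmaps
  have hgopen : IsOpenMap (κU.source.domRestrict g) := by
    rw [isOpenMap_iff_nhds_le]
    rintro ⟨a, ha⟩ S hS
    obtain ⟨u, hu, huS⟩ := mem_nhds_subtype _ _ _ |>.1 hS
    have hT : u ∩ κU.source ∈ 𝓝 a := inter_mem hu (κU.open_source.mem_nhds ha)
    refine mem_of_superset (image_mem_nhds_of_continuousOn_of_injOn hT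
      (hgc.mono Set.inter_subset_right) (hgi.mono Set.inter_subset_right)) ?_
    rintro _ ⟨x, ⟨hxu, hx⟩, rfl⟩
    exact huS (show (⟨x, hx⟩ : κU.source) ∈ Subtype.val ⁻¹' u from hxu)
  let ψ : OpenPartialHomeomorph ℝ ℝ := OpenPartialHomeomorph.ofContinuousOpenRestrict
    (hgi.toPartialEquiv g _) hgc hgopen κU.open_source
  refine ⟨ψ.symm.trans κU, ?_, ?_, ?_⟩
  · have hr' : r ∈ κU.source := ⟨hr, hr, ht₀⟩
    refine ⟨κU.map_source hr', ?_⟩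
    change κU.symm (κU r) ∈ κU.source
    rwa [κU.left_inv hr']
  · rintro t ⟨ht, -⟩
    rw [← κU.right_inv ht]
    exact hmaps (κU.map_target ht)
  · rintro t ⟨ht, -⟩
    change f (κU (κU.symm t)) = f t
    rw [κU.right_inv ht]

end Circle

/-! ### Adapted frames along a Frenet curve -/

section AdaptedFrames

variable {V : Type*} [NormedAddCommGroup V] [NormedSpace ℝ V] {ω : LinearMap.BilinForm ℝ V}

/-- The frame `(v, w)` spans the line and the plane of the flag `F` and is normalized with respect
to the affine chart given by `A : V → ℝ²`: the first coordinate is `1` on `v`, and `w` is sent to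
`(0, 1)`. -/
structure IsAdaptedFrame (A : V →L[ℝ] (Fin 2 → ℝ)) (F : IsotropicFlag ω) (v w : V) : Prop where
  mem_line : v ∈ F.sub 1
  mem_plane : w ∈ F.sub 2
  apply_line : A v 0 = 1
  apply_plane : A w = ![0, 1]

namespace IsAdaptedFrame

variable {A : V →L[ℝ] (Fin 2 → ℝ)} {F : IsotropicFlag ω} {v w : V}

lemma ne_zero (h : IsAdaptedFrame A F v w) : v ≠ 0 := by
  rintro rfl
  simpa using h.apply_line

lemma span_line (h : IsAdaptedFrame A F v w) : F.sub 1 = Submodule.span ℝ {v} := by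
  have hfin : finrank ℝ (F.sub 1) = 1 := F.finrank_sub 1
  have : FiniteDimensional ℝ (F.sub 1) := FiniteDimensional.of_finrank_pos (by omega)
  refine (Submodule.eq_of_le_of_finrank_eq ?_ ?_).symm
  · rw [Submodule.span_le, Set.singleton_subset_iff]
    exact h.mem_line
  · rw [finrank_span_singleton h.ne_zero, hfin]

lemma linearIndependent (h : IsAdaptedFrame A F v w) : LinearIndependent ℝ ![v, w] := by
  rw [LinearIndependent.pair_iff]
  intro s t hst
  have h0 := congr_arg (fun y => A y 0) hst
  have h1 := congr_arg (fun y => A y 1) hst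
  simp [h.apply_line, h.apply_plane] at h0
  subst h0
  simpa [h.apply_plane] using h1

lemma span_plane (h : IsAdaptedFrame A F v w) : F.sub 2 = Submodule.span ℝ {v, w} := by
  have hfin : finrank ℝ (F.sub 2) = 2 := F.finrank_sub 2
  have : FiniteDimensional ℝ (F.sub 2) := FiniteDimensional.of_finrank_pos (by omega)
  refine (Submodule.eq_of_le_of_finrank_eq ?_ ?_).symm
  · rw [Submodule.span_le]
    rintro x (rfl | rfl)
    · exact F.mono (by decide) h.mem_line
    · exact h.mem_plane
  · have := finrank_span_eq_card h.linearIndependent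
    rw [Matrix.range_cons_cons_empty, Fintype.card_fin] at this
    rw [this, hfin]

lemma eq_zero_of_mem_line (h : IsAdaptedFrame A F v w) {y : V} (hy : y ∈ F.sub 1)
    (hy0 : A y 0 = 0) : y = 0 := by
  rw [h.span_line] at hy
  obtain ⟨a, rfl⟩ := Submodule.mem_span_singleton.1 hy
  have : a = 0 := by simpa [h.apply_line] using hy0
  simp [this]

lemma eq_zero_of_mem_plane (h : IsAdaptedFrame A F v w) {y : V} (hy : y ∈ F.sub 2)
    (hy0 : A y = 0) : y = 0 := by
  rw [h.span_plane] at hy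
  obtain ⟨a, b, rfl⟩ := Submodule.mem_span_pair.1 hy
  have h0 := congr_fun hy0 0
  have h1 := congr_fun hy0 1
  simp [h.apply_line, h.apply_plane] at h0
  subst h0
  simp [h.apply_plane] at h1
  simp [h1]

end IsAdaptedFrame

lemma exists_isAdaptedFrame [FiniteDimensional ℝ V] (F : IsotropicFlag ω) :
    ∃ (A : V →L[ℝ] (Fin 2 → ℝ)) (v w : V), IsAdaptedFrame A F v w := by
  obtain ⟨v, hv, hv0⟩ : ∃ v ∈ F.sub 1, v ≠ 0 := by
    refine Submodule.exists_mem_ne_zero_of_ne_bot fun h => ?_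
    have := F.finrank_sub 1
    rw [h, finrank_bot] at this
    norm_num at this
  obtain ⟨w, hw, hwv⟩ : ∃ w ∈ F.sub 2, w ∉ Submodule.span ℝ {v} := by
    by_contra! hle
    have h1 := Submodule.finrank_mono (show F.sub 2 ≤ Submodule.span ℝ {v} from hle)
    rw [F.finrank_sub, finrank_span_singleton hv0] at h1
    norm_num at h1
  have hli : LinearIndependent ℝ ![v, w] := by
    rw [LinearIndependent.pair_iff' hv0]
    intro a ha
    exact hwv (Submodule.mem_span_singleton.2 ⟨a, ha⟩)
  obtain ⟨B, hB⟩ := LinearMap.exists_extend (Basis.span hli).equivFun.toLinearMap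
  have hBi : ∀ i, B (![v, w] i) = Pi.single i 1 := by
    intro i
    have h1 := LinearMap.congr_fun hB (Basis.span hli i)
    rw [LinearMap.comp_apply, Submodule.subtype_apply, Basis.span_apply] at h1
    rw [h1]
    ext j
    simp [Finsupp.single_apply, Pi.single_apply, eq_comm]
  refine ⟨LinearMap.toContinuousLinearMap B, v, w, hv, hw, ?_, ?_⟩
  · simpa using congr_fun (hBi 0) 0
  · have := hBi 1
    ext j
    fin_cases j
    · simpa using congr_fun this 0
    · simpa using congr_fun this 1

/-- The filter of triples of distinct points of the circle that tend to `t`. -/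
def distinctTriples (t : UnitAddCircle) :
    Filter (UnitAddCircle × UnitAddCircle × UnitAddCircle) :=
  𝓝 (t, t, t) ⊓ 𝓟 {s | s.1 ≠ s.2.1 ∧ s.1 ≠ s.2.2 ∧ s.2.1 ≠ s.2.2}

lemma tendsto_fst_distinctTriples (t : UnitAddCircle) :
    Tendsto (fun s => s.1) (distinctTriples t) (𝓝 t) :=
  (continuous_fst.tendsto (t, t, t)).mono_left inf_le_left

lemma tendsto_snd_distinctTriples (t : UnitAddCircle) :
    Tendsto (fun s => s.2.1) (distinctTriples t) (𝓝 t) :=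
  ((continuous_fst.comp continuous_snd).tendsto (t, t, t)).mono_left inf_le_left

lemma IsotropicFlag.sub_zero [FiniteDimensional ℝ V] (F : IsotropicFlag ω) :
    F.sub 0 = ⊥ :=
  Submodule.finrank_eq_zero.1 (F.finrank_sub 0)

/-- The first coordinate of `A`, as a chart of the lines. -/
noncomputable def lineChart (A : V →L[ℝ] (Fin 2 → ℝ)) : V →L[ℝ] (Fin 1 → ℝ) :=
  ContinuousLinearMap.pi fun _ => (ContinuousLinearMap.proj 0).comp A

@[simp] lemma lineChart_apply (A : V →L[ℝ] (Fin 2 → ℝ)) (y : V) (i : Fin 1) : lineChart A y i = A y 0 := rfl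

section Frenet

variable [FiniteDimensional ℝ V] {ξ : UnitAddCircle → IsotropicFlag ω}

lemma IsFrenet.tendsto_line (hξ : IsFrenet ξ) (t : UnitAddCircle) :
    GrassmannTendsto 1 (fun s => (ξ s.1).sub 1) (distinctTriples t) ((ξ t).sub 1) := by
  have h := hξ 1 0 0 1 (by decide) (by decide) (by decide) (by decide) (by decide) t
  simp only [IsotropicFlag.sub_zero, sup_bot_eq] at h
  exact h

lemma IsFrenet.tendsto_plane (hξ : IsFrenet ξ) (t : UnitAddCircle) :
    GrassmannTendsto 2 (fun s => (ξ s.1).sub 2) (distinctTriples t) ((ξ t).sub 2) := by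
  have h := hξ 2 0 0 2 (by decide) (by decide) (by decide) (by decide) (by decide) t
  simp only [IsotropicFlag.sub_zero, sup_bot_eq] at h
  exact h

lemma IsFrenet.tendsto_secant (hξ : IsFrenet ξ) (t : UnitAddCircle) :
    GrassmannTendsto 2 (fun s => (ξ s.1).sub 1 ⊔ (ξ s.2.1).sub 1) (distinctTriples t)
      ((ξ t).sub 2) := by
  have h := hξ 1 1 0 2 (by decide) (by decide) (by decide) (by decide) (by decide) t
  simp only [IsotropicFlag.sub_zero, sup_bot_eq] at h
  exact h

variable {A : V →L[ℝ] (Fin 2 → ℝ)}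

lemma IsFrenet.eventually_exists_isAdaptedFrame (hξ : IsFrenet ξ) {t : UnitAddCircle} {v w : V}
    (h : IsAdaptedFrame A (ξ t) v w) : ∀ᶠ s in 𝓝 t, ∃ v' w', IsAdaptedFrame A (ξ s) v' w' := by
  refine eventually_nhds_of_eventually_triple ?_
  filter_upwards [(hξ.tendsto_line t).eventually_exists (lineChart A)
      fun y hy hy0 => h.eq_zero_of_mem_line hy (congr_fun hy0 0),
    (hξ.tendsto_plane t).eventually_exists A fun y hy hy0 => h.eq_zero_of_mem_plane hy hy0]
    with s hs₁ hs₂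
  obtain ⟨v', hv', hv'1⟩ := hs₁ fun _ => 1
  obtain ⟨w', hw', hw'1⟩ := hs₂ ![0, 1]
  exact ⟨v', w', hv', hw', congr_fun hv'1 0, hw'1⟩

variable {v w : UnitAddCircle → V} {t : UnitAddCircle}

lemma IsFrenet.continuousAt_line (hξ : IsFrenet ξ)
    (h : ∀ᶠ s in 𝓝 t, IsAdaptedFrame A (ξ s) (v s) (w s)) : ContinuousAt v t := by
  have ht := h.self_of_nhds
  have key : Tendsto (fun s => v s.1) (distinctTriples t) (𝓝 (v t)) := by
    refine (hξ.tendsto_line t).tendsto_of_apply_eq (lineChart A)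
      (fun y hy hy0 => ht.eq_zero_of_mem_line hy (congr_fun hy0 0)) ht.mem_line ?_
    filter_upwards [(tendsto_fst_distinctTriples t).eventually h] with s hs
    exact ⟨hs.mem_line, funext fun _ => hs.apply_line.trans ht.apply_line.symm⟩
  exact fun S hS => eventually_nhds_of_eventually_triple (S := fun s => v s ∈ S) (key hS)

lemma IsFrenet.continuousAt_plane (hξ : IsFrenet ξ)
    (h : ∀ᶠ s in 𝓝 t, IsAdaptedFrame A (ξ s) (v s) (w s)) : ContinuousAt w t := by
  have ht := h.self_of_nhds
  have key : Tendsto (fun s => w s.1) (distinctTriples t) (𝓝 (w t)) := by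
    refine (hξ.tendsto_plane t).tendsto_of_apply_eq A
      (fun y hy hy0 => ht.eq_zero_of_mem_plane hy hy0) ht.mem_plane ?_
    filter_upwards [(tendsto_fst_distinctTriples t).eventually h] with s hs
    exact ⟨hs.mem_plane, hs.apply_plane.trans ht.apply_plane.symm⟩
  exact fun S hS => eventually_nhds_of_eventually_triple (S := fun s => w s ∈ S) (key hS)

/-- Distinct nearby points have distinct second coordinates: otherwise the second coordinate would
vanish wherever the first does on the secant plane `ξ(s)⁽¹⁾ ⊕ ξ(s')⁽¹⁾`, on which `A` is
bijective. -/
lemma IsFrenet.eventually_coordinate_ne (hξ : IsFrenet ξ)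
    (h : ∀ᶠ s in 𝓝 t, IsAdaptedFrame A (ξ s) (v s) (w s)) :
    ∀ᶠ s in distinctTriples t, A (v s.1) 1 ≠ A (v s.2.1) 1 := by
  have ht := h.self_of_nhds
  filter_upwards [(hξ.tendsto_secant t).eventually_exists A
      fun y hy hy0 => ht.eq_zero_of_mem_plane hy hy0,
    (tendsto_fst_distinctTriples t).eventually h,
    (tendsto_snd_distinctTriples t).eventually h] with s hs h₁ h₂ heq
  obtain ⟨y, hy, hy01⟩ := hs ![0, 1]
  rw [h₁.span_line, h₂.span_line, ← Submodule.span_insert] at hy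
  obtain ⟨a, b, rfl⟩ := Submodule.mem_span_pair.1 hy
  have h0 := congr_fun hy01 0
  have h1 := congr_fun hy01 1
  simp [h₁.apply_line, h₂.apply_line] at h0
  simp [heq] at h1
  rw [← add_mul, h0, zero_mul] at h1
  exact zero_ne_one h1

lemma IsFrenet.eventually_pair_coordinate_ne (hξ : IsFrenet ξ)
    (h : ∀ᶠ s in 𝓝 t, IsAdaptedFrame A (ξ s) (v s) (w s)) :
    ∀ᶠ s in 𝓝 (t, t) ⊓ 𝓟 {s : UnitAddCircle × UnitAddCircle | s.1 ≠ s.2},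
      A (v s.1) 1 ≠ A (v s.2) 1 :=
  eventually_pair_of_eventually_triple (S := fun s => A (v s.1) 1 ≠ A (v s.2) 1)
    (hξ.eventually_coordinate_ne h)

/-- The curve is strictly differentiable with derivative `w` with respect to the second coordinate
of the chart: its difference quotients are the normalized directions of the secant planes. -/
lemma IsFrenet.tendsto_slope (hξ : IsFrenet ξ)
    (h : ∀ᶠ s in 𝓝 t, IsAdaptedFrame A (ξ s) (v s) (w s)) :
    Tendsto (fun s : UnitAddCircle × UnitAddCircle =>
        (A (v s.1) 1 - A (v s.2) 1)⁻¹ • (v s.1 - v s.2))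
      (𝓝 (t, t) ⊓ 𝓟 {s | s.1 ≠ s.2}) (𝓝 (w t)) := by
  have ht := h.self_of_nhds
  have key : Tendsto (fun s => (A (v s.1) 1 - A (v s.2.1) 1)⁻¹ • (v s.1 - v s.2.1))
      (distinctTriples t) (𝓝 (w t)) := by
    refine (hξ.tendsto_secant t).tendsto_of_apply_eq A
      (fun y hy hy0 => ht.eq_zero_of_mem_plane hy hy0) ht.mem_plane ?_
    filter_upwards [hξ.eventually_coordinate_ne h,
      (tendsto_fst_distinctTriples t).eventually h,
      (tendsto_snd_distinctTriples t).eventually h] with s hne h₁ h₂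
    refine ⟨Submodule.smul_mem _ _ (Submodule.sub_mem _ (Submodule.mem_sup_left h₁.mem_line)
      (Submodule.mem_sup_right h₂.mem_line)), ?_⟩
    rw [ht.apply_plane]
    ext j
    fin_cases j
    · simp [h₁.apply_line, h₂.apply_line]
    · simp [inv_mul_cancel₀ (sub_ne_zero.2 hne)]
  exact fun S hS => eventually_pair_of_eventually_triple
    (S := fun s => (A (v s.1) 1 - A (v s.2) 1)⁻¹ • (v s.1 - v s.2) ∈ S) (key hS)

end Frenet

end AdaptedFrames

/-! ### The regular parametrization by the lines -/

section RegularParametrization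

variable {V : Type*} [NormedAddCommGroup V] [NormedSpace ℂ V] {ω : LinearMap.BilinForm ℝ V}
  {ξ : UnitAddCircle → IsotropicFlag ω}

lemma IsotropicFlag.submodule_point (F : IsotropicFlag ω) : F.point.submodule = F.sub 1 :=
  Projectivization.submodule_mk'' _ _

/-- Near every point, a Frenet curve of flags has a continuous adapted frame. -/
lemma IsFrenet.exists_local_frame [FiniteDimensional ℝ V] (hξ : IsFrenet ξ) (t₀ : UnitAddCircle) :
    ∃ (A : V →L[ℝ] (Fin 2 → ℝ)) (v w : UnitAddCircle → V),
      ∀ᶠ t in 𝓝 t₀, IsAdaptedFrame A (ξ t) (v t) (w t) := by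
  obtain ⟨A, v₀, w₀, h₀⟩ := exists_isAdaptedFrame (ξ t₀)
  have h : ∀ t, ∃ p : V × V, (∃ v w, IsAdaptedFrame A (ξ t) v w) →
      IsAdaptedFrame A (ξ t) p.1 p.2 := by
    intro t
    by_cases ht : ∃ v w, IsAdaptedFrame A (ξ t) v w
    · obtain ⟨v, w, hvw⟩ := ht
      exact ⟨(v, w), fun _ => hvw⟩
    · exact ⟨0, fun h => absurd h ht⟩
  choose p hp using h
  exact ⟨A, fun t => (p t).1, fun t => (p t).2,
    (hξ.eventually_exists_isAdaptedFrame h₀).mono fun t ht => hp t ht⟩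

/-- The lines of a Frenet curve form an immersed projective curve of class `C¹` whose tangent
lines are given by the planes of the flags. -/
theorem IsFrenet.exists_isRegularParam [FiniteDimensional ℝ V] (hξ : IsFrenet ξ)
    (t₀ : UnitAddCircle) :
    ∃ φ v, IsRegularParam (fun t => (ξ t).point) φ v ∧ t₀ ∈ φ.target ∧
      ∀ s ∈ φ.source, (ξ (φ s)).sub 2 = Submodule.span ℝ {v s, deriv v s} := by
  obtain ⟨A, v, w, hvw⟩ := hξ.exists_local_frame t₀
  have hne := hξ.eventually_pair_coordinate_ne hvw
  rw [eventually_inf_principal, nhds_prod_eq, eventually_prod_iff] at hne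
  obtain ⟨p, hp, q, hq, hne⟩ := hne
  -- a neighbourhood on which the frame exists and the second coordinate is injective
  obtain ⟨U, hUsub, hU, ht₀U⟩ := eventually_nhds_iff.1 (hvw.and (hp.and hq))
  have hframe : ∀ t ∈ U, ∀ᶠ s in 𝓝 t, IsAdaptedFrame A (ξ s) (v s) (w s) := fun t ht =>
    (hU.eventually_mem ht).mono fun s hs => (hUsub s hs).1
  have hinj : U.InjOn fun t => A (v t) 1 := by
    intro x hx y hy hxy
    by_contra hne'
    exact hne (hUsub x hx).2.1 (hUsub y hy).2.2 hne' hxy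
  have hcont : ContinuousOn (fun t => A (v t) 1) U := fun t ht =>
    (((continuous_apply 1).comp A.continuous).continuousAt.comp
      (hξ.continuousAt_line (hframe t ht))).continuousWithinAt
  obtain ⟨φ, ht₀, hφU, hφ⟩ := exists_openPartialHomeomorph_symm_eq hU hcont hinj ht₀U
  have hmem : ∀ s ∈ φ.source, φ s ∈ U := fun s hs => hφU (φ.map_source hs)
  have hcoord : ∀ s ∈ φ.source, A (v (φ s)) 1 = s := fun s hs => by
    rw [← hφ _ (φ.map_source hs), φ.left_inv hs]
  have hderiv : ∀ s ∈ φ.source, HasDerivAt (fun s => v (φ s)) (w (φ s)) s := by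
    intro s hs
    rw [hasDerivAt_iff_tendsto_slope]
    have hpair : Tendsto (fun y => (φ y, φ s)) (𝓝[≠] s)
        (𝓝 (φ s, φ s) ⊓ 𝓟 {x : UnitAddCircle × UnitAddCircle | x.1 ≠ x.2}) := by
      refine tendsto_inf.2 ⟨?_, tendsto_principal.2 ?_⟩
      · exact (((φ.continuousAt hs).prodMk continuousAt_const).tendsto).mono_left
          nhdsWithin_le_nhds
      · filter_upwards [nhdsWithin_le_nhds (φ.open_source.mem_nhds hs), self_mem_nhdsWithin]
          with y hy hys h
        exact hys (φ.injOn hy hs h)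
    refine ((hξ.tendsto_slope (hframe _ (hmem s hs))).comp hpair).congr' ?_
    filter_upwards [nhdsWithin_le_nhds (φ.open_source.mem_nhds hs)] with y hy
    simp only [Function.comp_apply, hcoord y hy, hcoord s hs]
    rfl
  have hw : ContinuousOn (fun s => w (φ s)) φ.source := fun s hs =>
    ((hξ.continuousAt_plane (hframe _ (hmem s hs))).comp (φ.continuousAt hs)).continuousWithinAt
  refine ⟨φ, fun s => v (φ s), ⟨?_, ?_, ?_⟩, ht₀, ?_⟩
  · rw [show (1 : WithTop ℕ∞) = 0 + 1 by norm_num,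
      contDiffOn_succ_iff_deriv_of_isOpen φ.open_source]
    refine ⟨fun s hs => (hderiv s hs).differentiableAt.differentiableWithinAt, by simp, ?_⟩
    rw [contDiffOn_zero]
    exact hw.congr fun s hs => (hderiv s hs).deriv
  · intro s hs
    rw [(hderiv s hs).deriv]
    exact (hUsub _ (hmem s hs)).1.linearIndependent
  · intro s hs
    rw [IsotropicFlag.submodule_point]
    exact (hUsub _ (hmem s hs)).1.span_line
  · intro s hs
    rw [(hderiv s hs).deriv]
    exact (hUsub _ (hmem s hs)).1.span_plane

lemma IsFrenet.hasTangentLine [FiniteDimensional ℝ V] (hξ : IsFrenet ξ) (t : UnitAddCircle) :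
    HasTangentLine (fun s => (ξ s).point) t ((ξ t).sub 2) := by
  obtain ⟨φ, v, hv, ht, hspan⟩ := hξ.exists_isRegularParam t
  refine ⟨φ, v, hv, ht, ?_⟩
  rw [← hspan _ (φ.map_target ht), φ.right_inv ht]

/-- The tangent lines are Legendrian because the planes of isotropic flags are Lagrangian. -/
lemma IsFrenet.isLegendrian [FiniteDimensional ℝ V] (hξ : IsFrenet ξ) :
    IsLegendrian ω (fun t => (ξ t).point) := by
  intro t
  obtain ⟨φ, v, hv, ht, hspan⟩ := hξ.exists_isRegularParam t
  refine ⟨φ, v, hv, ht, fun s hs => ?_⟩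
  have hv' : v s ∈ (ξ (φ s)).sub 2 := by
    rw [hspan s hs]; exact Submodule.subset_span (by simp)
  have hw' : deriv v s ∈ (ξ (φ s)).sub 2 := by
    rw [hspan s hs]; exact Submodule.subset_span (by simp)
  rw [show (2 : Fin 5) = Fin.rev 2 by decide, (ξ (φ s)).sub_rev] at hw'
  exact (LinearMap.BilinForm.mem_orthogonal_iff.1 hw') _ hv'

end RegularParametrization

/-! ### The projection to the complex projective line -/

section Projection

variable {V : Type*} [NormedAddCommGroup V] [NormedSpace ℂ V] {ω : LinearMap.BilinForm ℝ V}
  {ξ : UnitAddCircle → IsotropicFlag ω}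

lemma IsPositiveCurve.pairing_ne_zero (hω : ω.IsAlt) (hξ : IsPositiveCurve ξ)
    {s t : UnitAddCircle} (hst : s ≠ t) {v w : V} (hv : v ∈ (ξ s).sub 1) (hw : w ∈ (ξ t).sub 1)
    (hv0 : v ≠ 0) (hw0 : w ≠ 0) : ω v w ≠ 0 := by
  obtain ⟨r, -, hr⟩ := (infinite_of_mem_nhds_unitAddCircle
    (t := s) univ_mem).exists_notMem_finset {s, t}
  simp only [Finset.mem_insert, Finset.mem_singleton, not_or] at hr
  by_cases h : btw t r s
  · have h' : sbtw t r s := sbtw_iff_btw_not_btw.2 ⟨h, fun h' => by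
      rcases h.antisymm h' with h | h | h
      exacts [hr.2 h.symm, hr.1 h, hst h]⟩
    intro h0
    refine (hξ _ _ _ h').pairing_ne_zero hw hv hw0 hv0 ?_
    rw [← hω.neg_eq, h0, neg_zero]
  · exact (hξ _ _ _ (sbtw_iff_not_btw.2 h)).pairing_ne_zero hv hw hv0 hw0

/-- Complex lines are isotropic for a real symplectic form that is anti-invariant under `i`. -/
lemma apply_smul_self_eq_zero (hω : ω.IsAlt)
    (hanti : ∀ u v : V, ω (Complex.I • u) (Complex.I • v) = -ω u v) (z : ℂ) (v : V) :
    ω (z • v) v = 0 := by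
  have h1 : ω (Complex.I • v) v = 0 := by
    have h2 := hanti v (Complex.I • v)
    rw [smul_smul, Complex.I_mul_I, neg_one_smul, map_neg, neg_inj] at h2
    have h3 := hω.neg_eq v (Complex.I • v)
    linarith
  have hz : z • v = z.re • v + z.im • Complex.I • v := by
    conv_lhs => rw [← Complex.re_add_im z]
    rw [add_smul, mul_smul]
    simp only [Complex.coe_smul]
  rw [hz, map_add, map_smul, map_smul, LinearMap.add_apply, LinearMap.smul_apply,
    LinearMap.smul_apply, hω v, h1]
  simp

lemma realToComplex_mk {v : V} (hv : v ≠ 0) :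
    realToComplex (Projectivization.mk ℝ v hv) = Projectivization.mk ℂ v hv := rfl

lemma IsotropicFlag.point_eq_mk (F : IsotropicFlag ω) {v : V} (hv : v ≠ 0)
    (h : F.sub 1 = Submodule.span ℝ {v}) : F.point = Projectivization.mk ℝ v hv := by
  apply Projectivization.submodule_injective
  rw [F.submodule_point, h, Projectivization.submodule_mk]

/-- The projection of a positive curve to the complex projective line is injective: a complex line
is Lagrangian, whereas distinct lines of the curve are not orthogonal. This persists under
symplectic maps. -/
lemma IsPositiveCurve.injective_projection (hω : ω.IsAlt)
    (hanti : ∀ u v : V, ω (Complex.I • u) (Complex.I • v) = -ω u v) (hξ : IsPositiveCurve ξ)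
    (g : V ≃ₗ[ℝ] V) (hg : ∀ u v, ω (g u) (g v) = ω u v) :
    Function.Injective fun t =>
      realToComplex (Projectivization.map g.toLinearMap g.injective (ξ t).point) := by
  intro s t hst
  by_contra hne
  have hs0 := (ξ s).point.rep_nonzero
  have ht0 := (ξ t).point.rep_nonzero
  have hs : (ξ s).point.rep ∈ (ξ s).sub 1 := by
    rw [← IsotropicFlag.submodule_point, Projectivization.submodule_eq]
    exact Submodule.mem_span_singleton_self _
  have ht : (ξ t).point.rep ∈ (ξ t).sub 1 := by
    rw [← IsotropicFlag.submodule_point, Projectivization.submodule_eq]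
    exact Submodule.mem_span_singleton_self _
  refine hξ.pairing_ne_zero hω hne hs ht hs0 ht0 ?_
  simp only at hst
  rw [← (ξ s).point.mk_rep, ← (ξ t).point.mk_rep, Projectivization.map_mk,
    Projectivization.map_mk, realToComplex_mk, realToComplex_mk,
    Projectivization.mk_eq_mk_iff'] at hst
  obtain ⟨z, hz⟩ := hst
  rw [← hg]
  change z • g (ξ t).point.rep = g (ξ s).point.rep at hz
  rw [← hz]
  exact apply_smul_self_eq_zero hω hanti z _

lemma IsFrenet.continuous_projection [FiniteDimensional ℝ V] (hξ : IsFrenet ξ) (g : V ≃ₗ[ℝ] V) :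
    Continuous fun t =>
      realToComplex (Projectivization.map g.toLinearMap g.injective (ξ t).point) := by
  rw [continuous_iff_continuousAt]
  intro t₀
  obtain ⟨A, v, w, hvw⟩ := hξ.exists_local_frame t₀
  have h₀ := hvw.self_of_nhds
  classical
  -- a lift of the curve to nonzero vectors near `t₀`, extended by a constant
  let u : UnitAddCircle → {x : V // x ≠ 0} := fun t =>
    if h : g (v t) ≠ 0 then ⟨g (v t), h⟩ else ⟨g (v t₀), by simpa using h₀.ne_zero⟩
  have hu : ∀ᶠ t in 𝓝 t₀, (u t : V) = g (v t) := by
    filter_upwards [hvw] with t ht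
    have : g (v t) ≠ 0 := by simpa using ht.ne_zero
    simp only [u, dif_pos this]
  have hgc : Continuous g := g.toLinearMap.continuous_of_finiteDimensional
  have hcont : ContinuousAt u t₀ := by
    refine Topology.IsInducing.subtypeVal.continuousAt_iff.2 ?_
    exact (hgc.continuousAt.comp (hξ.continuousAt_line hvw)).congr
      (hu.mono fun t ht => ht.symm)
  have hmk : Continuous (Projectivization.mk' ℂ : {x : V // x ≠ 0} → ℙ ℂ V) :=
    continuous_quotient_mk'
  refine (hmk.continuousAt.comp hcont).congr ?_
  filter_upwards [hvw, hu] with t ht hut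
  rw [(ξ t).point_eq_mk ht.ne_zero ht.span_line, Projectivization.map_mk, realToComplex_mk,
    Function.comp_apply, Projectivization.mk'_eq_mk]
  congr 1

lemma isRoundCircle_complexImage {L : Submodule ℝ V} (hL : finrank ℝ L = 2) :
    IsRoundCircle (complexImage L) := by
  have : FiniteDimensional ℝ L := FiniteDimensional.of_finrank_pos (by omega)
  let b := finBasisOfFinrankEq ℝ L hL
  have hspan : L = Submodule.span ℝ {(b 0 : V), (b 1 : V)} := by
    have h := congr_arg (Submodule.map L.subtype) b.span_eq
    rw [Submodule.map_span, Submodule.map_top, Submodule.range_subtype, ← Set.range_comp] at h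
    refine h.symm.trans (congr_arg _ ?_)
    ext x
    simp [Fin.exists_fin_two, eq_comm]
  have hb0 : (b 0 : V) ≠ 0 := by simpa using b.ne_zero 0
  by_cases hli : LinearIndependent ℂ ![(b 0 : V), (b 1 : V)]
  · exact Or.inl ⟨_, _, hli, by rw [← hspan]⟩
  -- otherwise `L` lies in a complex line
  right
  rw [LinearIndependent.pair_iff' hb0] at hli
  push Not at hli
  obtain ⟨z, hz⟩ := hli
  have hmul : ∀ x ∈ L, ∃ c : ℂ, c • (b 0 : V) = x := by
    intro x hx
    rw [hspan] at hx
    obtain ⟨s, t, rfl⟩ := Submodule.mem_span_pair.1 hx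
    refine ⟨(s : ℂ) + t * z, ?_⟩
    rw [add_smul, mul_smul, hz, Complex.coe_smul, Complex.coe_smul]
  refine ⟨Projectivization.mk ℂ (b 0 : V) hb0, ?_⟩
  ext x
  constructor
  · rintro ⟨v, hv, hvL, rfl⟩
    exact (Projectivization.mk_eq_mk_iff' _ _ _ _ _).2 (hmul v hvL)
  · rintro rfl
    exact ⟨_, hb0, (b 0).2, rfl⟩

lemma IsPositiveCurve.hasDecreasingCurvature [FiniteDimensional ℝ V] (hξ : IsPositiveCurve ξ)
    (hFrenet : IsFrenet ξ) : HasDecreasingCurvature ω fun t => (ξ t).point := by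
  refine ⟨fun t => (ξ t).sub 2, hFrenet.hasTangentLine, fun t₁ t₂ t₃ h => ?_⟩
  have h₁₃ := (hξ _ _ _ h).isCompl
  have h' := sbtw_cyclic_left h
  exact ⟨(hξ _ _ _ h').isCompl.symm, (hξ _ _ _ (sbtw_cyclic_left h')).isCompl.symm, h₁₃,
    (hξ _ _ _ h).maslovIndex_eq_one h₁₃⟩

end Projection

theorem mainTheorem4 {V : Type*} [NormedAddCommGroup V] [NormedSpace ℂ V]
    (hV : finrank ℝ V = 4) (ω : LinearMap.BilinForm ℝ V) (hω_alt : ω.IsAlt)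
    (hω_nondeg : ω.Nondegenerate)
    (hω_anti : ∀ u v : V, ω (Complex.I • u) (Complex.I • v) = -ω u v)
    (ξ : UnitAddCircle → IsotropicFlag ω) (hFrenet : IsFrenet ξ) (hpos : IsPositiveCurve ξ) :
    ∃ γ : UnitAddCircle → ℙ ℂ V,
      IsSimpleClosedCurve γ ∧
      IsContactLift ω (fun t => (ξ t).point) γ ∧
      HasDecreasingCurvature ω (fun t => (ξ t).point) ∧
      (∀ t, HasTangentLine (fun s => (ξ s).point) t ((ξ t).sub 2) ∧
        IsOsculatingCircle (fun s => (ξ s).point) t (complexImage ((ξ t).sub 2))) ∧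
      ∀ g : V ≃ₗ[ℝ] V, (∀ u v, ω (g u) (g v) = ω u v) →
        IsSimpleClosedCurve fun t =>
          realToComplex (Projectivization.map g.toLinearMap g.injective (ξ t).point) := by
  have : FiniteDimensional ℝ V := FiniteDimensional.of_finrank_pos (by omega)
  have hsimple : ∀ g : V ≃ₗ[ℝ] V, (∀ u v, ω (g u) (g v) = ω u v) →
      IsSimpleClosedCurve fun t =>
        realToComplex (Projectivization.map g.toLinearMap g.injective (ξ t).point) :=
    fun g hg => ⟨hFrenet.continuous_projection g,
      hpos.injective_projection hω_alt hω_anti g hg⟩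
  have hid := hsimple (LinearEquiv.refl ℝ V) fun _ _ => rfl
  simp only [LinearEquiv.refl_toLinearMap, Projectivization.map_id, id] at hid
  exact ⟨fun t => realToComplex (ξ t).point, hid, ⟨hFrenet.isLegendrian, fun _ => rfl⟩,
    hpos.hasDecreasingCurvature hFrenet, fun t => ⟨hFrenet.hasTangentLine t,
      isRoundCircle_complexImage ((ξ t).finrank_sub 2), _, hFrenet.hasTangentLine t, rfl⟩, hsimple⟩
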